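/- **Theorem (generalization bound for the Proxy Margin Discrepancy).** Let $\mathcal X$ be a measurable space and $\mathcal Y=\{1,\dots,K\}$ with $K\ge 2$, and let $\rho>0$. Let $\mathcal F$ be a set of measurable scoring functions $f:\mathcal X\to\mathbb R^K$, written $f(x,y)=[f(x)]_y$. Each $f$ induces the labelling function $h_f(x)=\arg\max_{y}f(x,y)$, where ties are broken by a fixed measurable rule on score vectors. Let $H$ be a set of labelling functions $h:\mathcal X\to\mathcal Y$ that contains $h_f$ for every $f\in\mathcal F$ and is closed under relabelling: $\tau\circ h\in H$ for all $h\in H$ and all permutations $\tau$ of $\mathcal Y$. (For instance, $H=\{h_f : f\in\mathcal F\}$ if this set is closed under relabelling.) Put $$\Pi_H^{\mathcal F}=\{x\mapsto f(x,h(x)) : h\in H,\ f\in\mathcal F\}.$$ Define the margin $\rho_{f}(x,y)=\tfrac12\big(f(x,y)-\max_{y'\neq y}f(x,y')\big)$ and the $\rho$-margin loss $\Phi_\rho(t)=\min\{1,\max\{0,1-t/\rho\}\}$. For a probability distribution $D$ on $\mathcal X$ and $f,f'\in\mathcal F$ let $$\mathrm{disp}_D^{(\rho)}(f',f)=\mathbb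 E_{x\sim D}\,\Phi_\rho\big(\rho_{f'}(x,h_f(x))\big),\qquad d^{(\rho)}_{f,\mathcal F}(D_1,D_2)=\sup_{f'\in\mathcal F}\big(\mathrm{disp}_{D_2}^{(\rho)}(f',f)-\mathrm{disp}_{D_1}^{(\rho)}(f',f)\big).$$ Let $Q_n$ (noisy source), $Q'$ (proxy) and $P$ (target) be probability distributions on $\mathcal X$. Let $\hat Q_n,\hat Q',\hat P$ be the empirical distributions of mutually independent i.i.d. samples of sizes $m,u,n\ge1$ drawn from $Q_n,Q',P$ respectively. The proxy margin discrepancies are $$d_\Lambda^{(\rho)}(Q_n,P)=d^{(\rho)}_{f,\mathcal F}(Q_n,Q')+d^{(\rho)}_{f,\mathcal F}(Q',P),\qquad d_\Lambda^{(\rho)}(\hat Q_n,\hat P)=d^{(\rho)}_{f,\mathcal F}(\hat Q_n,\hat Q')+d^{(\rho)}_{f,\mathcal F}(\hat Q',\hat P).$$ For a class $\mathcal G$ of real functions on $\mathcal X$, let $$\mathfrak R_{N,D}(\mathcal G)=\mathbb E_{x_1,\dots,x_N\sim D}\,\mathbb E_\sigma\,\sup_{g\in\mathcal G}\frac1N\sum_{i=1}^N\sigma_i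 g(x_i)\in[0,\infty]$$ be its Rademacher complexity, where $\sigma$ is uniform on $\{-1,1\}^N$. Assume, for each $D\in\{Q_n,Q',P\}$, that $\Pi_H^{\mathcal F}$ and the class $\{x\mapsto\Phi_\rho(\rho_{f'}(x,h_f(x)))-\mathrm{disp}^{(\rho)}_D(f',f) : f,f'\in\mathcal F\}$ are $D$-measurable. Here $\mathcal G$ is called $D$-measurable if for all $N$ and $a\in\mathbb R^N$ the function $(x_1,\dots,x_N)\mapsto\sup_{g\in\mathcal G}\sum_i a_i g(x_i)$ is measurable with respect to the completion of $D^{N}$. (This holds, for example, for countable $\mathcal F$ and countable $H$ consisting of measurable functions.) Then for every $\delta>0$, with probability at least $1-2\delta$ over the samples, the following holds simultaneously for all $f\in\mathcal F$: $$\big|d_\Lambda^{(\rho)}(\hat Q_n,\hat P)-d_\Lambda^{(\rho)}(Q_n,P)\big|\le\frac{2K}{\rho}\mathfrak R_{m,Q_n}(\Pi_H^{\mathcal F})+\frac{4K}{\rho}\mathfrak R_{u,Q'}(\Pi_H^{\mathcal F})+\frac{2K}{\rho}\mathfrak R_{n,P}(\Pi_H^{\mathcal F})+\sqrt{\frac{\log\frac2\delta}{2m}}+2\sqrt{\frac{\log\frac2\delta}{2u}}+\sqrt{\frac{\log\frac2\delta}{2n}}.$$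 Here the square root of a negative number (which occurs only for $\delta>2$, where the claim is void) is read as $0$. If the exceptional event is not measurable, the claim is that its outer probability is at most $2\delta$. -/

import Mathlib

open MeasureTheory
open scoped ENNReal

namespace PMD

noncomputable section

/-- `sel` is a rule selecting a maximal coordinate of every score vector (with some
tie-breaking), so that `h_f x = sel (f x)` is an `argmax` over `y` of `f x y`. -/
def IsArgmaxRule {K : ℕ} (sel : (Fin K → ℝ) → Fin K) : Prop :=
  ∀ (v : Fin K → ℝ) (y : Fin K), v y ≤ v (sel v)

/-- The labelling function `h_f` induced by the scoring function `f`. -/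
def induced {X : Type*} {K : ℕ} (sel : (Fin K → ℝ) → Fin K) (f : X → Fin K → ℝ) : X → Fin K :=
  fun x => sel (f x)

/-- The margin `ρ_f(x, y) = (f(x, y) - max_{y' ≠ y} f(x, y')) / 2`. -/
def margin {X : Type*} {K : ℕ} (f : X → Fin K → ℝ) (x : X) (y : Fin K) : ℝ :=
  (f x y - ⨆ y' : {y' : Fin K // y' ≠ y}, f x y') / 2

/-- The `ρ`-margin loss: `1` on `(-∞, 0]`, `1 - t / ρ` on `[0, ρ]`, `0` on `[ρ, ∞)`. -/
def marginLoss (ρ t : ℝ) : ℝ := min 1 (max 0 (1 - t / ρ))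

/-- The margin disparity `disp_Q^{(ρ)}(f', f) = E_{x ∼ Q} Φ_ρ(ρ_{f'}(x, h_f(x)))`. -/
def disp {X : Type*} [MeasurableSpace X] {K : ℕ} (sel : (Fin K → ℝ) → Fin K) (ρ : ℝ)
    (Q : Measure X) (f' f : X → Fin K → ℝ) : ℝ :=
  ∫ x, marginLoss ρ (margin f' x (induced sel f x)) ∂Q

/-- The margin disparity discrepancy
`d_{f,F}^{(ρ)}(Q, P) = sup_{f' ∈ F} (disp_P(f', f) - disp_Q(f', f))`. -/
def mdd {X : Type*} [MeasurableSpace X] {K : ℕ} (sel : (Fin K → ℝ) → Fin K) (ρ : ℝ)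
    (F : Set (X → Fin K → ℝ)) (f : X → Fin K → ℝ) (Q P : Measure X) : ℝ :=
  ⨆ f' : F, (disp sel ρ P f' f - disp sel ρ Q f' f)

/-- The proxy margin discrepancy of `Qn` and `P` with proxy distribution `Q'`. -/
def pmd {X : Type*} [MeasurableSpace X] {K : ℕ} (sel : (Fin K → ℝ) → Fin K) (ρ : ℝ)
    (F : Set (X → Fin K → ℝ)) (f : X → Fin K → ℝ) (Qn Q' P : Measure X) : ℝ :=
  mdd sel ρ F f Qn Q' + mdd sel ρ F f Q' P

/-- The empirical distribution of a sample of size `N`. -/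
def empirical {X : Type*} [MeasurableSpace X] {N : ℕ} (S : Fin N → X) : Measure X :=
  (N : ℝ≥0∞)⁻¹ • ∑ i, Measure.dirac (S i)

/-- The law of an i.i.d. sample of size `N` drawn from `D`. -/
def sampleLaw {X : Type*} [MeasurableSpace X] (N : ℕ) (D : Measure X) : Measure (Fin N → X) :=
  Measure.pi fun _ => D

/-- The class `Π_H F = {x ↦ f(x, h(x)) | h ∈ H, f ∈ F}`. -/
def piClass {X : Type*} {K : ℕ} (H : Set (X → Fin K)) (F : Set (X → Fin K → ℝ)) :
    Set (X → ℝ) :=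
  {g | ∃ h ∈ H, ∃ f ∈ F, g = fun x => f x (h x)}

/-- The class of margin losses centred at their `D`-mean:
`{x ↦ Φ_ρ(ρ_{f'}(x, h_f(x))) - disp_D(f', f) | f, f' ∈ F}`. -/
def centeredLossClass {X : Type*} [MeasurableSpace X] {K : ℕ} (sel : (Fin K → ℝ) → Fin K)
    (ρ : ℝ) (F : Set (X → Fin K → ℝ)) (D : Measure X) : Set (X → ℝ) :=
  {g | ∃ f' ∈ F, ∃ f ∈ F,
    g = fun x => marginLoss ρ (margin f' x (induced sel f x)) - disp sel ρ D f' f}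

/-- `sup_{g ∈ G} ∑ i, a i * g (S i)`, which may be infinite. -/
def weightedSup {X : Type*} {N : ℕ} (G : Set (X → ℝ)) (a : Fin N → ℝ) (S : Fin N → X) : EReal :=
  ⨆ g ∈ G, ((∑ i, a i * g (S i) : ℝ) : EReal)

/-- The random sign attached to `b`. -/
def sign (b : Bool) : ℝ := if b then 1 else -1

/-- The empirical Rademacher complexity: the average over all sign vectors `σ ∈ {-1, 1}^N` of
`sup_{g ∈ G} (1 / N) ∑ i, σ_i g(x_i)`.  It is nonnegative for a nonempty class `G`, and is `∞` if
one of the suprema is. -/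
def empRademacher {X : Type*} {N : ℕ} (G : Set (X → ℝ)) (S : Fin N → X) : ℝ≥0∞ :=
  (((((2 : ℝ) ^ N)⁻¹ : ℝ) : EReal) *
    ∑ σ : Fin N → Bool, weightedSup G (fun i => sign (σ i) / N) S).toENNReal

/-- The Rademacher complexity `R_{N,D}(G)`: the expectation of the empirical one over a sample of
size `N` drawn from `D`. -/
def rademacher {X : Type*} [MeasurableSpace X] (N : ℕ) (D : Measure X) (G : Set (X → ℝ)) :
    ℝ≥0∞ :=
  ∫⁻ S, empRademacher G S ∂(sampleLaw N D)

/-- `G` is a `D`-measurable class of functions: all weighted suprema over `G` of i.i.d. samples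
from `D` are measurable, up to completion of the law of the sample. -/
def IsMeasurableClass {X : Type*} [MeasurableSpace X] (D : Measure X) (G : Set (X → ℝ)) : Prop :=
  ∀ (N : ℕ) (a : Fin N → ℝ), AEMeasurable (weightedSup G a) (sampleLaw N D)

end

end PMD

namespace PMD

/-! Everything reduces to one-sided uniform deviations, suprema over pairs (f', f) of ± (empirical
minus true disparity). Both signed errors of the proxy margin discrepancy are at most a sum of four
of them: one for the source, one for the target, and both signs for the proxy, whose distribution
enters twice (`abs_pmd_sub_le`). Taking the supremum over f as well makes the bound uniform in f.

The mean of such a supremum is bounded by symmetrization with a ghost sample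
(`integral_indexedSup_le`) and the contraction principle (`signSup_lipschitz_le`). The margin is
half of a difference between a score and a maximum of K-1 scores; since H is closed under
relabelling, all K are evaluations of members of `piClass H F`. Together with the Lipschitz constant
1/ρ this costs K/(2ρ) (`signSup_marginLoss_le`), and symmetrization doubles it.

The fluctuation is sub-Gaussian by bounded differences (`hasSubgaussianMGF_of_bounded_differences`).
The three independent samples are treated jointly, with variance proxy 1/(4m) + 1/u + 1/(4n), so
each signed error fails with probability at most δ/2. This gives complexity coefficients K/ρ, 2K/ρ,
K/ρ and total failure probability δ, both a factor 2 better than claimed. -/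

theorem sign_not (b : Bool) : sign (!b) = -sign b := by cases b <;> simp [sign]

theorem abs_sign (b : Bool) : |sign b| = 1 := by cases b <;> simp [sign]

/-! ### Suprema of signed sums and the contraction principle. -/

/-- Uniform boundedness of an indexed family of vectors. -/
def UnifBdd {T ι : Type*} (v : T → ι → ℝ) : Prop := ∃ B, ∀ t i, |v t i| ≤ B

/-- The sum over all sign vectors `σ` of `sup_t ∑ i, σ i * v t i`. -/
noncomputable def signSup {T ι : Type*} [Fintype ι] [DecidableEq ι] (v : T → ι → ℝ) : ℝ :=
  ∑ σ : ι → Bool, ⨆ t, ∑ i, sign (σ i) * v t i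

section

variable {T ι : Type*}

theorem UnifBdd.bddAbove [Fintype ι] {v : T → ι → ℝ} (hv : UnifBdd v) (a : ι → ℝ) :
    BddAbove (Set.range fun t => ∑ i, a i * v t i) := by
  obtain ⟨B, hB⟩ := hv
  refine ⟨∑ i, |a i| * B, ?_⟩
  rintro _ ⟨t, rfl⟩
  refine Finset.sum_le_sum fun i _ => (le_abs_self _).trans ?_
  rw [abs_mul]
  exact mul_le_mul_of_nonneg_left (hB t i) (abs_nonneg _)

theorem UnifBdd.add {v w : T → ι → ℝ} (hv : UnifBdd v) (hw : UnifBdd w) :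
    UnifBdd fun t i => v t i + w t i := by
  obtain ⟨B, hB⟩ := hv
  obtain ⟨C, hC⟩ := hw
  exact ⟨B + C, fun t i => (abs_add_le _ _).trans (add_le_add (hB t i) (hC t i))⟩

theorem UnifBdd.const_mul {v : T → ι → ℝ} (hv : UnifBdd v) (r : ℝ) :
    UnifBdd fun t i => r * v t i := by
  obtain ⟨B, hB⟩ := hv
  refine ⟨|r| * B, fun t i => ?_⟩
  rw [abs_mul]
  exact mul_le_mul_of_nonneg_left (hB t i) (abs_nonneg _)

theorem UnifBdd.neg {v : T → ι → ℝ} (hv : UnifBdd v) : UnifBdd fun t i => -v t i := by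
  simpa using hv.const_mul (-1)

theorem UnifBdd.comp_lipschitz {v : T → ι → ℝ} (hv : UnifBdd v) {φ : ℝ → ℝ} {L : ℝ}
    (hL : 0 ≤ L) (hφ : ∀ a b, |φ a - φ b| ≤ L * |a - b|) : UnifBdd fun t i => φ (v t i) := by
  obtain ⟨B, hB⟩ := hv
  refine ⟨L * B + |φ 0|, fun t i => ?_⟩
  have h1 := hφ (v t i) 0
  rw [sub_zero] at h1
  have h2 := abs_sub_abs_le_abs_sub (φ (v t i)) (φ 0)
  have h3 := mul_le_mul_of_nonneg_left (hB t i) hL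
  linarith

theorem UnifBdd.sup {v w : T → ι → ℝ} (hv : UnifBdd v) (hw : UnifBdd w) :
    UnifBdd fun t i => max (v t i) (w t i) := by
  obtain ⟨B, hB⟩ := hv
  obtain ⟨C, hC⟩ := hw
  exact ⟨max B C, fun t i => abs_max_le_max_abs_abs.trans (max_le_max (hB t i) (hC t i))⟩

variable [Fintype ι] [DecidableEq ι]

theorem signSup_add_le [Nonempty T] {v w : T → ι → ℝ} (hv : UnifBdd v) (hw : UnifBdd w) :
    signSup (fun t i => v t i + w t i) ≤ signSup v + signSup w := by
  rw [signSup, signSup, signSup, ← Finset.sum_add_distrib]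
  refine Finset.sum_le_sum fun σ _ => ciSup_le fun t => ?_
  simp only [mul_add, Finset.sum_add_distrib]
  exact add_le_add (le_ciSup (hv.bddAbove fun i => sign (σ i)) t)
    (le_ciSup (hw.bddAbove fun i => sign (σ i)) t)

theorem signSup_const_mul {r : ℝ} (hr : 0 ≤ r) (v : T → ι → ℝ) :
    signSup (fun t i => r * v t i) = r * signSup v := by
  rw [signSup, signSup, Finset.mul_sum]
  refine Finset.sum_congr rfl fun σ _ => ?_
  rw [Real.mul_iSup_of_nonneg hr]
  refine iSup_congr fun t => ?_
  rw [Finset.mul_sum]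
  exact Finset.sum_congr rfl fun i _ => by ring

theorem signSup_neg (v : T → ι → ℝ) : signSup (fun t i => -v t i) = signSup v := by
  rw [signSup, signSup]
  refine Fintype.sum_equiv (Equiv.arrowCongr (Equiv.refl ι) Equiv.boolNot) _ _ fun σ => ?_
  refine iSup_congr fun t => Finset.sum_congr rfl fun i _ => ?_
  simp [Equiv.arrowCongr, sign_not]

theorem signSup_comp_le {T' : Type*} [Nonempty T'] {v : T → ι → ℝ} (hv : UnifBdd v)
    (φ : T' → T) : signSup (fun t i => v (φ t) i) ≤ signSup v :=
  Finset.sum_le_sum fun σ _ => ciSup_le fun t => le_ciSup (hv.bddAbove fun i => sign (σ i)) (φ t)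

/-- The two-point case of contraction: for near-maximizers s, t on the left, b s - b t is at most L
|a s - a t|, and the sign of a s - a t decides which of s, t is tested in which supremum on the
right. -/
theorem iSup_add_iSup_le_of_lipschitz [Nonempty T] {u a b : T → ℝ} {L : ℝ}
    (h : ∀ s t, |b s - b t| ≤ L * |a s - a t|)
    (h1 : BddAbove (Set.range fun t => u t + L * a t))
    (h2 : BddAbove (Set.range fun t => u t - L * a t)) :
    (⨆ t, (u t + b t)) + ⨆ t, (u t - b t) ≤ (⨆ t, (u t + L * a t)) + ⨆ t, (u t - L * a t) := by
  refine ciSup_add_ciSup_le fun s t => ?_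
  have h0 := (le_abs_self _).trans (h s t)
  rcases le_total 0 (a s - a t) with hs | hs
  · rw [abs_of_nonneg hs] at h0
    have := le_ciSup h1 s
    have := le_ciSup h2 t
    beta_reduce at *
    linarith
  · rw [abs_of_nonpos hs] at h0
    have := le_ciSup h1 t
    have := le_ciSup h2 s
    beta_reduce at *
    linarith

theorem two_mul_signSup (j : ι) (v : T → ι → ℝ) :
    2 * signSup v = ∑ σ : ι → Bool,
      ((⨆ t, ((∑ i ∈ Finset.univ.erase j, sign (σ i) * v t i) + sign (σ j) * v t j)) +
        ⨆ t, ((∑ i ∈ Finset.univ.erase j, sign (σ i) * v t i) - sign (σ j) * v t j)) := by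
  rw [Finset.sum_add_distrib, two_mul]
  congr 1
  · refine Finset.sum_congr rfl fun σ _ => iSup_congr fun t => ?_
    exact (Finset.sum_erase_add _ _ (Finset.mem_univ j)).symm
  -- Flipping the sign at `j` permutes the sign vectors, so the second copy of the sum may carry the
  -- opposite sign there.
  · let e : (ι → Bool) ≃ (ι → Bool) :=
      Function.Involutive.toPerm (fun σ => Function.update σ j (!σ j)) fun σ => by simp
    refine Fintype.sum_equiv e _ _ fun σ => iSup_congr fun t => ?_
    rw [← Finset.sum_erase_add _ _ (Finset.mem_univ j), sub_eq_add_neg]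
    congr 1
    · refine Finset.sum_congr rfl fun i hi => ?_
      simp [e, Function.Involutive.toPerm, Function.update_of_ne (Finset.ne_of_mem_erase hi)]
    · simp [e, Function.Involutive.toPerm, sign_not]

/-- Replacing one coordinate by a Lipschitz image of it. -/
theorem signSup_le_of_coordinate [Nonempty T] (j : ι) {v w : T → ι → ℝ} (hv : UnifBdd v) {L : ℝ}
    {a : T → ℝ} (hj : ∀ t, v t j = L * a t) (h : ∀ s t, |w s j - w t j| ≤ L * |a s - a t|)
    (hne : ∀ t, ∀ i ≠ j, w t i = v t i) : signSup w ≤ signSup v := by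
  suffices 2 * signSup w ≤ 2 * signSup v by linarith
  rw [two_mul_signSup j, two_mul_signSup j]
  refine Finset.sum_le_sum fun σ _ => ?_
  have hu : ∀ t, ∑ i ∈ Finset.univ.erase j, sign (σ i) * w t i =
      ∑ i ∈ Finset.univ.erase j, sign (σ i) * v t i := fun t =>
    Finset.sum_congr rfl fun i hi => by rw [hne t i (Finset.ne_of_mem_erase hi)]
  have h1 := hv.bddAbove fun i => sign (σ i)
  have h2 := hv.bddAbove fun i => sign (Function.update σ j (!σ j) i)
  have e1 : ∀ t, ∑ i, sign (σ i) * v t i =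
      (∑ i ∈ Finset.univ.erase j, sign (σ i) * v t i) + L * (sign (σ j) * a t) := fun t => by
    rw [← Finset.sum_erase_add _ _ (Finset.mem_univ j), hj]; ring
  have e2 : ∀ t, ∑ i, sign (Function.update σ j (!σ j) i) * v t i =
      (∑ i ∈ Finset.univ.erase j, sign (σ i) * v t i) - L * (sign (σ j) * a t) := fun t => by
    rw [← Finset.sum_erase_add _ _ (Finset.mem_univ j), hj, Function.update_self, sign_not]
    rw [Finset.sum_congr rfl fun i hi => by
      rw [Function.update_of_ne (Finset.ne_of_mem_erase hi)]]
    ring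
  simp only [e1] at h1
  simp only [e2] at h2
  simp only [hu, hj]
  have key := iSup_add_iSup_le_of_lipschitz (b := fun t => sign (σ j) * w t j)
    (fun s t => by
      rw [← mul_sub, ← mul_sub, abs_mul, abs_mul, abs_sign, one_mul, one_mul]; exact h s t) h1 h2
  simpa only [mul_left_comm (sign (σ j)) L] using key

/-- The contraction principle. -/
theorem signSup_lipschitz_le [Nonempty T] {v : T → ι → ℝ} (hv : UnifBdd v) {φ : ℝ → ℝ} {L : ℝ}
    (hL : 0 ≤ L) (hφ : ∀ a b, |φ a - φ b| ≤ L * |a - b|) :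
    signSup (fun t i => φ (v t i)) ≤ L * signSup v := by
  rw [← signSup_const_mul hL]
  have hb : ∀ s : Finset ι, UnifBdd fun t i => if i ∈ s then φ (v t i) else L * v t i := by
    intro s
    obtain ⟨B, hB⟩ := hv.comp_lipschitz hL hφ
    obtain ⟨C, hC⟩ := hv.const_mul L
    refine ⟨max B C, fun t i => ?_⟩
    beta_reduce
    split_ifs
    · exact (hB t i).trans (le_max_left _ _)
    · exact (hC t i).trans (le_max_right _ _)
  -- Hybrid argument: L times the identity is exchanged for φ one coordinate at a time.
  have key : ∀ s : Finset ι, signSup (fun t i => if i ∈ s then φ (v t i) else L * v t i) ≤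
      signSup fun t i => L * v t i := by
    intro s
    induction s using Finset.induction_on with
    | empty => simp
    | insert j s hj ih =>
      refine (signSup_le_of_coordinate j (hb s) (L := L) (a := fun t => v t j) ?_ ?_ ?_).trans ih
      · intro t; simp [hj]
      · intro t t'; simpa using hφ _ _
      · intro t i hi; simp [hi]
  simpa using key Finset.univ

/-- Uses max(a, b) = (a + b + |a - b|)/2 and contraction for the 1-Lipschitz absolute value. -/
theorem signSup_max_le [Nonempty T] {v w : T → ι → ℝ} (hv : UnifBdd v) (hw : UnifBdd w) :
    signSup (fun t i => max (v t i) (w t i)) ≤ signSup v + signSup w := by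
  have hd : UnifBdd fun t i => v t i + -w t i := hv.add hw.neg
  have habs : ∀ a b : ℝ, |(|a| - |b|)| ≤ 1 * |a - b| := fun a b => by
    rw [one_mul]; exact abs_abs_sub_abs_le_abs_sub a b
  have h1 : signSup (fun t i => max (v t i) (w t i)) =
      (1 / 2) * signSup fun t i => (v t i + w t i) + |v t i + -w t i| := by
    rw [← signSup_const_mul (by norm_num)]
    congr 1
    ext t i
    rw [max_def]
    split_ifs with h
    · rw [abs_of_nonpos (by linarith)]; ring
    · rw [abs_of_nonneg (by linarith)]; ring
  have h2 := signSup_add_le (hv.add hw) (hd.comp_lipschitz zero_le_one habs)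
  have h3 := signSup_lipschitz_le hd zero_le_one habs
  have h4 := signSup_add_le hv hw.neg
  have h5 := signSup_add_le hv hw
  rw [signSup_neg] at h4
  linarith

theorem signSup_sup'_le [Nonempty T] {κ : Type*} {v : κ → T → ι → ℝ} (hv : ∀ k, UnifBdd (v k))
    {s : Finset κ} (hs : s.Nonempty) :
    UnifBdd (fun t i => s.sup' hs fun k => v k t i) ∧
      signSup (fun t i => s.sup' hs fun k => v k t i) ≤ ∑ k ∈ s, signSup (v k) := by
  induction hs using Finset.Nonempty.cons_induction with
  | singleton k => simpa using hv k
  | cons k s hk hs ih =>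
    simp only [Finset.sup'_cons hs, Finset.sum_cons]
    exact ⟨(hv k).sup ih.1, (signSup_max_le (hv k) ih.1).trans (by gcongr; exact ih.2)⟩

end

/-! ### Bounded differences via sub-Gaussian moment generating functions. -/

section

open ProbabilityTheory

instance {X : Type*} [MeasurableSpace X] (N : ℕ) (D : Measure X) [IsProbabilityMeasure D] :
    IsProbabilityMeasure (sampleLaw N D) := by
  unfold sampleLaw; infer_instance

theorem integrable_of_abs_le {α : Type*} [MeasurableSpace α] {μ : Measure α} [IsFiniteMeasure μ]
    {f : α → ℝ} {M : ℝ} (hf : AEMeasurable f μ) (hM : ∀ a, |f a| ≤ M) : Integrable f μ :=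
  Integrable.of_mem_Icc (-M) M hf (ae_of_all _ fun a => abs_le.1 (hM a))

/-- Inductive step for bounded differences. Conditionally on a, the fluctuation around the
conditional mean g(a) has proxy v; g itself ranges over an interval of length c, so Hoeffding's
lemma contributes (c/2)². -/
theorem hasSubgaussianMGF_prod {α β : Type*} [MeasurableSpace α] [MeasurableSpace β]
    {μ : Measure α} {ν : Measure β} [IsProbabilityMeasure μ] [IsProbabilityMeasure ν]
    {f : α × β → ℝ} {M : ℝ} {v : NNReal} {c : NNReal} (hf : AEMeasurable f (μ.prod ν))
    (hM : ∀ z, |f z| ≤ M)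
    (hv : ∀ᵐ a ∂μ, HasSubgaussianMGF (fun b => f (a, b) - ∫ b, f (a, b) ∂ν) v ν)
    (hc : ∀ a a' b, f (a, b) ≤ f (a', b) + c) :
    HasSubgaussianMGF (fun z => f z - ∫ z, f z ∂(μ.prod ν)) (v + (c / 2) ^ 2) (μ.prod ν) := by
  set g : α → ℝ := fun a => ∫ b, f (a, b) ∂ν with hg
  have hfi : Integrable f (μ.prod ν) := integrable_of_abs_le hf hM
  have hgi : Integrable g μ := hfi.integral_prod_left
  have hE : ∫ z, f z ∂(μ.prod ν) = ∫ a, g a ∂μ := integral_prod _ hfi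
  have hexp : ∀ t, Integrable (fun z => Real.exp (t * (f z - ∫ z, f z ∂(μ.prod ν)))) (μ.prod ν) :=
    fun t => integrable_exp_mul_of_mem_Icc (a := -M - ∫ z, f z ∂(μ.prod ν))
      (b := M - ∫ z, f z ∂(μ.prod ν)) (hf.sub_const _)
      (ae_of_all _ fun z => ⟨by linarith [(abs_le.1 (hM z)).1], by linarith [(abs_le.1 (hM z)).2]⟩)
  have hG : ∀ᵐ a ∂μ, Integrable (fun b => f (a, b)) ν := hfi.prod_right_ae
  obtain ⟨a₀, ha₀⟩ := hG.exists
  have hgc : ∀ a a', Integrable (fun b => f (a, b)) ν → Integrable (fun b => f (a', b)) ν →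
      g a ≤ g a' + c := by
    intro a a' ha ha'
    have := integral_mono ha (ha'.add (integrable_const (c : ℝ))) fun b => hc a a' b
    rw [integral_add' ha' (integrable_const _)] at this
    simpa using this
  -- Since f is only a.e. measurable, some slices may fail to be integrable; there g takes the
  -- default value 0, so they are kept out of the set whose infimum starts the interval.
  let S : Set ℝ := g '' {a | Integrable (fun b => f (a, b)) ν}
  have hS : S.Nonempty := ⟨_, a₀, ha₀, rfl⟩
  have hSb : BddBelow S := by
    refine ⟨g a₀ - c, ?_⟩
    rintro _ ⟨a, ha, rfl⟩
    linarith [hgc a₀ a ha₀ ha]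
  have hIcc : ∀ᵐ a ∂μ, g a ∈ Set.Icc (sInf S) (sInf S + c) := by
    filter_upwards [hG] with a ha
    refine ⟨csInf_le hSb ⟨a, ha, rfl⟩, ?_⟩
    have : g a - c ≤ sInf S := by
      refine le_csInf hS ?_
      rintro _ ⟨a', ha', rfl⟩
      linarith [hgc a a' ha ha']
    linarith
  have hsg := hasSubgaussianMGF_of_mem_Icc hgi.aemeasurable hIcc
  rw [add_sub_cancel_left, ← hE] at hsg
  refine ⟨hexp, fun t => ?_⟩
  have key : ∀ᵐ a ∂μ, ∫ b, Real.exp (t * (f (a, b) - ∫ z, f z ∂(μ.prod ν))) ∂ν ≤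
      Real.exp (t * (g a - ∫ z, f z ∂(μ.prod ν))) * Real.exp (v * t ^ 2 / 2) := by
    filter_upwards [hv] with a ha
    have h1 : ∀ b, Real.exp (t * (f (a, b) - ∫ z, f z ∂(μ.prod ν))) =
        Real.exp (t * (g a - ∫ z, f z ∂(μ.prod ν))) * Real.exp (t * (f (a, b) - g a)) := by
      intro b
      rw [← Real.exp_add]
      ring_nf
    simp only [h1]
    rw [integral_const_mul]
    exact mul_le_mul_of_nonneg_left (ha.mgf_le t) (Real.exp_pos _).le
  rw [mgf, integral_prod _ (hexp t)]
  refine (integral_mono_ae (hexp t).integral_prod_left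
    ((hsg.integrable_exp_mul t).mul_const _) key).trans ?_
  rw [integral_mul_const]
  refine (mul_le_mul_of_nonneg_right (hsg.mgf_le t) (Real.exp_pos _).le).trans ?_
  rw [← Real.exp_add]
  refine Real.exp_le_exp.2 (le_of_eq ?_)
  simp
  ring

/-- The bounded differences inequality, for functions that are measurable up to completion. -/
theorem hasSubgaussianMGF_of_bounded_differences {X : Type*} [MeasurableSpace X] (D : Measure X)
    [IsProbabilityMeasure D] {M : ℝ} {c : NNReal} (N : ℕ) {f : (Fin N → X) → ℝ}
    (hf : AEMeasurable f (sampleLaw N D)) (hM : ∀ S, |f S| ≤ M)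
    (hc : ∀ S i x, f (Function.update S i x) ≤ f S + c) :
    HasSubgaussianMGF (fun S => f S - ∫ S, f S ∂(sampleLaw N D)) (N * (c / 2) ^ 2)
      (sampleLaw N D) := by
  induction N with
  | zero =>
    have : (fun S => f S - ∫ S, f S ∂(sampleLaw 0 D)) = fun _ => 0 := by
      ext S
      have : ∀ S', f S' = f S := fun S' => by rw [Subsingleton.elim S' S]
      simp [this]
    rw [this]
    simp
  | succ N ih =>
    let e := MeasurableEquiv.piFinSuccAbove (fun _ : Fin (N + 1) => X) 0
    have he : MeasurePreserving e (sampleLaw (N + 1) D) (D.prod (sampleLaw N D)) :=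
      measurePreserving_piFinSuccAbove (fun _ => D) 0
    have hes : ∀ x S, e.symm (x, S) = Fin.cons x S := fun x S => by
      simp [e, MeasurableEquiv.piFinSuccAbove]
      rfl
    have hf' : AEMeasurable (fun z => f (e.symm z)) (D.prod (sampleLaw N D)) := by
      refine AEMeasurable.comp_quasiMeasurePreserving hf ?_
      exact (he.symm e).quasiMeasurePreserving
    have hE : ∫ S, f S ∂(sampleLaw (N + 1) D) = ∫ z, f (e.symm z) ∂(D.prod (sampleLaw N D)) :=
      ((he.symm e).integral_comp' f).symm
    have key : HasSubgaussianMGF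
        (fun z => f (e.symm z) - ∫ z, f (e.symm z) ∂(D.prod (sampleLaw N D)))
        (N * (c / 2) ^ 2 + (c / 2) ^ 2) (D.prod (sampleLaw N D)) := by
      refine hasSubgaussianMGF_prod hf' (fun z => hM _) ?_ ?_
      · filter_upwards [hf'.aestronglyMeasurable.prodMk_left] with x hx
        refine ih hx.aemeasurable (fun S => hM _) fun S i y => ?_
        rw [hes, hes, Fin.cons_update]
        exact hc _ _ _
      · intro x x' S
        have hu : (Fin.cons x S : Fin (N + 1) → X) = Function.update (Fin.cons x' S) 0 x :=
          (Fin.update_cons_zero (α := fun _ => X) x' S x).symm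
        rw [hes, hes, hu]
        exact hc _ _ _
    rw [← he.map_eq] at key
    have := HasSubgaussianMGF.of_map he.measurable.aemeasurable key
    rw [he.map_eq, ← hE] at this
    convert this using 1
    · ext S; simp
    · push_cast; ring

end

/-! ### Symmetrization by a ghost sample. -/

/-- The real-valued weighted supremum over an indexed family of functions. -/
noncomputable def indexedSup {T X ι : Type*} [Fintype ι] (c : T → X → ℝ) (a : ι → ℝ)
    (S : ι → X) : ℝ :=
  ⨆ t, ∑ i, a i * c t (S i)

section

/-- The permutation of two copies of `ι` exchanging the copies of `i` where `σ i = false`. -/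
def swapPerm {ι : Type*} (σ : ι → Bool) : Equiv.Perm (ι ⊕ ι) :=
  Function.Involutive.toPerm
    (Sum.elim (fun i => if σ i then .inl i else .inr i) fun i => if σ i then .inr i else .inl i)
    (by rintro (i | i) <;> by_cases h : σ i <;> simp [h])

/-- Random signs arise by exchanging sample and ghost points, which preserves the law of the doubled
i.i.d. sample. -/
theorem elim_comp_swapPerm {ι : Type*} (σ : ι → Bool) (w : ℝ) :
    Sum.elim (fun _ : ι => w) (fun _ : ι => -w) ∘ swapPerm σ =
      Sum.elim (fun i => w * sign (σ i)) fun i => -(w * sign (σ i)) := by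
  ext (i | i) <;> by_cases h : σ i <;>
    simp [swapPerm, Function.Involutive.toPerm, sign, h]

variable {T X ι ι' : Type*} [Fintype ι] [Fintype ι']

theorem indexedSup_piCongrLeft [MeasurableSpace X] (c : T → X → ℝ) (a : ι → ℝ) (e : ι' ≃ ι)
    (S : ι' → X) :
    indexedSup c a (MeasurableEquiv.piCongrLeft (fun _ => X) e S) = indexedSup c (a ∘ e) S := by
  refine iSup_congr fun t => ?_
  rw [← e.sum_comp]
  simp [MeasurableEquiv.coe_piCongrLeft, Equiv.piCongrLeft_apply_apply]

theorem bddAbove_indexedSup {c : T → X → ℝ} {B : ℝ} (hc : ∀ t x, |c t x| ≤ B) (a : ι → ℝ)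
    (S : ι → X) : BddAbove (Set.range fun t => ∑ i, a i * c t (S i)) :=
  UnifBdd.bddAbove (v := fun t i => c t (S i)) ⟨B, fun t i => hc t (S i)⟩ a

theorem abs_indexedSup_le [Nonempty T] {c : T → X → ℝ} {B : ℝ} (hc : ∀ t x, |c t x| ≤ B)
    (a : ι → ℝ) (S : ι → X) : |indexedSup c a S| ≤ ∑ i, |a i| * B := by
  have h : ∀ t, |∑ i, a i * c t (S i)| ≤ ∑ i, |a i| * B := fun t => by
    refine (Finset.abs_sum_le_sum_abs _ _).trans (Finset.sum_le_sum fun i _ => ?_)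
    rw [abs_mul]
    exact mul_le_mul_of_nonneg_left (hc t _) (abs_nonneg _)
  refine abs_le.2 ⟨?_, ciSup_le fun t => (abs_le.1 (h t)).2⟩
  obtain ⟨t⟩ := ‹Nonempty T›
  exact (abs_le.1 (h t)).1.trans (le_ciSup (bddAbove_indexedSup hc a S) t)

theorem signSup_mul_const [DecidableEq ι] (w : ℝ) (v : T → ι → ℝ) :
    signSup (fun t i => w * v t i) = |w| * signSup v := by
  rcases le_total 0 w with h | h
  · rw [signSup_const_mul h, abs_of_nonneg h]
  · rw [abs_of_nonpos h, ← signSup_const_mul (neg_nonneg.2 h), ← signSup_neg]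
    simp

/-- For weights summing to zero, centring is immaterial. -/
theorem sum_swapped_indexedSup_le [Nonempty T] [DecidableEq ι] {c g : T → X → ℝ} {b : T → ℝ}
    {B : ℝ} (hg : ∀ t x, |g t x| ≤ B) (hcg : ∀ t x, c t x = g t x - b t) (w : ℝ) (S S' : ι → X) :
    ∑ σ : ι → Bool, indexedSup c
        (Sum.elim (fun i => w * sign (σ i)) fun i => -(w * sign (σ i))) (Sum.elim S S') ≤
      |w| * signSup (fun t i => g t (S i)) + |w| * signSup (fun t i => g t (S' i)) := by
  have h1 : UnifBdd fun t i => g t (S i) := ⟨B, fun t i => hg t _⟩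
  have h2 : UnifBdd fun t i => g t (S' i) := ⟨B, fun t i => hg t _⟩
  have e2 := signSup_mul_const (-w) fun t i => g t (S' i)
  rw [abs_neg] at e2
  rw [← signSup_mul_const w, ← e2]
  refine le_trans (le_of_eq ?_) (signSup_add_le (h1.const_mul w) (h2.const_mul (-w)))
  refine Finset.sum_congr rfl fun σ _ => iSup_congr fun t => ?_
  rw [Fintype.sum_sum_type, ← Finset.sum_add_distrib]
  refine Finset.sum_congr rfl fun i _ => ?_
  simp only [Sum.elim_inl, Sum.elim_inr, hcg]
  ring

variable [MeasurableSpace X] {D : Measure X} [IsProbabilityMeasure D]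

theorem aemeasurable_indexedSup_comp {c : T → X → ℝ} {a : ι → ℝ} (e : ι' ≃ ι)
    (h : AEMeasurable (indexedSup c a) (Measure.pi fun _ : ι => D)) :
    AEMeasurable (indexedSup c (a ∘ e)) (Measure.pi fun _ : ι' => D) := by
  have := h.comp_quasiMeasurePreserving
    (measurePreserving_piCongrLeft (fun _ : ι => D) e).quasiMeasurePreserving
  exact this.congr (ae_of_all _ fun S => indexedSup_piCongrLeft c a e S)

theorem integral_indexedSup_comp (c : T → X → ℝ) (a : ι → ℝ) (e : ι' ≃ ι) :
    ∫ S, indexedSup c (a ∘ e) S ∂(Measure.pi fun _ : ι' => D) =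
      ∫ S, indexedSup c a S ∂(Measure.pi fun _ : ι => D) := by
  rw [← (measurePreserving_piCongrLeft (fun _ : ι => D) e).integral_comp'
    (indexedSup c a)]
  exact integral_congr_ae (ae_of_all _ fun S => (indexedSup_piCongrLeft c a e S).symm)

/-- Symmetrization by a ghost sample. -/
theorem integral_indexedSup_le [Nonempty T] [DecidableEq ι] {c g : T → X → ℝ} {b : T → ℝ} {B : ℝ}
    (hg : ∀ t x, |g t x| ≤ B) (hc : ∀ t x, |c t x| ≤ B) (hcm : ∀ t, Measurable (c t))
    (hcg : ∀ t x, c t x = g t x - b t) (hc0 : ∀ t, ∫ x, c t x ∂D = 0) (w : ℝ)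
    (hm : AEMeasurable (indexedSup c fun _ : ι => w) (Measure.pi fun _ : ι => D))
    (hm2 : AEMeasurable (indexedSup c (Sum.elim (fun _ : ι => w) fun _ : ι => -w))
      (Measure.pi fun _ : ι ⊕ ι => D))
    {r : (ι → X) → ℝ} (hr : Integrable r (Measure.pi fun _ : ι => D))
    (hle : ∀ᵐ S ∂(Measure.pi fun _ : ι => D),
      |w| * signSup (fun t i => g t (S i)) ≤ 2 ^ Fintype.card ι * r S) :
    ∫ S, indexedSup c (fun _ => w) S ∂(Measure.pi fun _ : ι => D) ≤
      2 * ∫ S, r S ∂(Measure.pi fun _ : ι => D) := by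
  set μ : Measure (ι → X) := Measure.pi fun _ : ι => D with hμ
  let e := (MeasurableEquiv.sumPiEquivProdPi fun _ : ι ⊕ ι => X).symm
  have he : MeasurePreserving e (μ.prod μ) (Measure.pi fun _ : ι ⊕ ι => D) :=
    measurePreserving_sumPiEquivProdPi_symm fun _ : ι ⊕ ι => D
  have hez : ∀ z, e z = Sum.elim z.1 z.2 := fun z => by ext (i | i) <;> rfl
  let A : (ι → Bool) → ι ⊕ ι → ℝ := fun σ =>
    Sum.elim (fun i => w * sign (σ i)) fun i => -(w * sign (σ i))
  have hA : ∀ σ, Integrable (fun z : (ι → X) × (ι → X) =>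
      indexedSup c (A σ) (Sum.elim z.1 z.2)) (μ.prod μ) := by
    intro σ
    refine integrable_of_abs_le ?_ fun z => abs_indexedSup_le hc _ _
    have h1 := aemeasurable_indexedSup_comp (swapPerm σ) hm2
    rw [elim_comp_swapPerm] at h1
    have h2 := h1.comp_quasiMeasurePreserving he.quasiMeasurePreserving
    exact h2.congr (ae_of_all _ fun z => by simp [hez, A])
  have hAi : ∀ σ, ∫ z, indexedSup c (A σ) (Sum.elim z.1 z.2) ∂(μ.prod μ) =
      ∫ S, indexedSup c (Sum.elim (fun _ : ι => w) fun _ : ι => -w) S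
        ∂(Measure.pi fun _ : ι ⊕ ι => D) := by
    intro σ
    rw [← integral_indexedSup_comp c _ (swapPerm σ), elim_comp_swapPerm, ← he.integral_comp']
    exact integral_congr_ae (ae_of_all _ fun z => by simp [hez, A])
  have hAt : A (fun _ => true) = Sum.elim (fun _ : ι => w) fun _ : ι => -w := by
    ext (i | i) <;> simp [A, sign]
  -- Jensen: the functions `c t` have mean zero, so the sum over S is the ghost average of the sum
  -- over S minus that over S', and a supremum of averages is at most the average of the supremum.
  have hjensen : ∫ S, indexedSup c (fun _ => w) S ∂μ ≤
      ∫ z, indexedSup c (A fun _ => true) (Sum.elim z.1 z.2) ∂(μ.prod μ) := by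
    rw [integral_prod _ (hA _)]
    refine integral_mono_ae (integrable_of_abs_le hm fun S => abs_indexedSup_le hc _ _)
      (hA _).integral_prod_left ?_
    filter_upwards [(hA fun _ => true).prod_right_ae] with S hS
    refine ciSup_le fun t => ?_
    have hci : ∀ i : ι, Integrable (fun S' : ι → X => c t (S' i)) μ := fun i =>
      integrable_of_abs_le ((hcm t).comp (measurable_pi_apply i)).aemeasurable fun S' => hc t _
    have hc0' : ∀ i : ι, ∫ S' : ι → X, c t (S' i) ∂μ = 0 := fun i => by
      rw [← hc0 t]
      have hp := (measurePreserving_eval (fun _ : ι => D) i)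
      have := integral_map (μ := μ) hp.measurable.aemeasurable (f := c t) (hcm t).aestronglyMeasurable
      rw [hμ, hp.map_eq] at this
      exact this.symm
    have hsum : ∫ S' : ι → X, (∑ i, w * c t (S i) + ∑ i, -w * c t (S' i)) ∂μ =
        ∑ i, w * c t (S i) := by
      rw [integral_add (integrable_const _)
        (integrable_finsetSum _ fun i _ => (hci i).const_mul (-w)),
        integral_finsetSum _ fun i _ => (hci i).const_mul (-w)]
      simp only [integral_const_mul, hc0']
      simp
    rw [← hsum]
    refine integral_mono ((integrable_const _).add
      (integrable_finsetSum _ fun i _ => (hci i).const_mul (-w))) hS fun S' => ?_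
    rw [hAt]
    refine le_trans (le_of_eq ?_) (le_ciSup (bddAbove_indexedSup hc _ _) t)
    simp [Fintype.sum_sum_type]
  have hpow : (0 : ℝ) < 2 ^ Fintype.card ι := by positivity
  have hr1 : Integrable (fun z : (ι → X) × (ι → X) => r z.1) (μ.prod μ) := hr.comp_fst μ
  have hr2 : Integrable (fun z : (ι → X) × (ι → X) => r z.2) (μ.prod μ) := hr.comp_snd μ
  -- All 2^|ι| sign patterns have the same integral by `hAi`, so one of them is replaced by the sum
  -- over all, to which the pointwise bound applies.
  have hsum : (2 : ℝ) ^ Fintype.card ι *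
      ∫ z, indexedSup c (A fun _ => true) (Sum.elim z.1 z.2) ∂(μ.prod μ) ≤
      2 ^ Fintype.card ι * (2 * ∫ S, r S ∂μ) := by
    have h1 : (2 : ℝ) ^ Fintype.card ι *
        ∫ z, indexedSup c (A fun _ => true) (Sum.elim z.1 z.2) ∂(μ.prod μ) =
        ∫ z, ∑ σ, indexedSup c (A σ) (Sum.elim z.1 z.2) ∂(μ.prod μ) := by
      rw [integral_finsetSum _ fun σ _ => hA σ]
      simp [hAi]
    have h2 : (2 : ℝ) ^ Fintype.card ι * (2 * ∫ S, r S ∂μ) =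
        ∫ z : (ι → X) × (ι → X), (2 ^ Fintype.card ι * r z.1 + 2 ^ Fintype.card ι * r z.2)
          ∂(μ.prod μ) := by
      rw [integral_add (hr1.const_mul _) (hr2.const_mul _), integral_const_mul,
        integral_const_mul, integral_fun_fst r, integral_fun_snd r]
      simp
      ring
    rw [h1, h2]
    refine integral_mono_ae (integrable_finsetSum _ fun σ _ => hA σ)
      ((hr1.const_mul _).add (hr2.const_mul _)) ?_
    filter_upwards [Measure.quasiMeasurePreserving_fst.ae hle,
      Measure.quasiMeasurePreserving_snd.ae hle] with z h1 h2
    exact (sum_swapped_indexedSup_le hg hcg w z.1 z.2).trans (add_le_add h1 h2)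
  exact hjensen.trans (le_of_mul_le_mul_left hsum hpow)

end

/-! ### From extended-valued suprema to real ones. -/

section

variable {X : Type*} {N : ℕ}

theorem weightedSup_range {T : Type*} [Nonempty T] (c : T → X → ℝ) (a : Fin N → ℝ)
    (S : Fin N → X) (hb : BddAbove (Set.range fun t => ∑ i, a i * c t (S i))) :
    weightedSup (Set.range c) a S = (indexedSup c a S : ℝ) := by
  rw [weightedSup, iSup_range]
  refine le_antisymm (iSup_le fun t => EReal.coe_le_coe_iff.2 (le_ciSup hb t)) ?_
  induction h : ⨆ t, ((∑ i, a i * c t (S i) : ℝ) : EReal) with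
  | bot =>
    obtain ⟨t⟩ := ‹Nonempty T›
    have := le_iSup (fun t => ((∑ i, a i * c t (S i) : ℝ) : EReal)) t
    rw [h] at this
    exact absurd (le_bot_iff.1 this) (EReal.coe_ne_bot _)
  | coe x =>
    refine EReal.coe_le_coe_iff.2 (ciSup_le fun t => EReal.coe_le_coe_iff.1 ?_)
    rw [← h]
    exact le_iSup (fun t => ((∑ i, a i * c t (S i) : ℝ) : EReal)) t
  | top => exact le_top

theorem EReal_sum_ne_bot {ι : Type*} (s : Finset ι) {w : ι → EReal} (hw : ∀ i, w i ≠ ⊥) :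
    ∑ i ∈ s, w i ≠ ⊥ := by
  classical
  induction s using Finset.induction_on with
  | empty => simp
  | insert j s hj ih =>
    rw [Finset.sum_insert hj, Ne, EReal.add_eq_bot_iff]
    exact not_or.2 ⟨hw j, ih⟩

theorem EReal_coe_sum {ι : Type*} (s : Finset ι) (w : ι → ℝ) :
    ((∑ i ∈ s, w i : ℝ) : EReal) = ∑ i ∈ s, (w i : EReal) :=
  map_sum (⟨⟨Real.toEReal, EReal.coe_zero⟩, EReal.coe_add⟩ : ℝ →+ EReal) w s

theorem weightedSup_ne_bot {G : Set (X → ℝ)} (hG : G.Nonempty) (a : Fin N → ℝ) (S : Fin N → X) :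
    weightedSup G a S ≠ ⊥ := by
  obtain ⟨g, hg⟩ := hG
  intro h
  have : ((∑ i, a i * g (S i) : ℝ) : EReal) ≤ weightedSup G a S :=
    le_iSup₂ (f := fun (g : X → ℝ) (_ : g ∈ G) => ((∑ i, a i * g (S i) : ℝ) : EReal)) g hg
  rw [h] at this
  exact absurd (le_bot_iff.1 this) (EReal.coe_ne_bot _)

/-- In `EReal`, ⊤ + ⊥ = ⊥; nonemptiness of G excludes ⊥, so a single infinite supremum makes the
whole average infinite. -/
theorem weightedSup_ne_top_of_empRademacher {G : Set (X → ℝ)} (hG : G.Nonempty) {S : Fin N → X}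
    (h : empRademacher G S ≠ ⊤) (σ : Fin N → Bool) :
    weightedSup G (fun i => sign (σ i) / N) S ≠ ⊤ := by
  intro hσ
  apply h
  rw [empRademacher, ← Finset.add_sum_erase _ _ (Finset.mem_univ σ), hσ,
    EReal.top_add_of_ne_bot (EReal_sum_ne_bot _ fun τ => weightedSup_ne_bot hG _ S),
    EReal.coe_mul_top_of_pos (by positivity), EReal.toENNReal_top]

/-- The sign vector matching the signs of g(S j) turns the signed sum into the mean of |g(S j)|, so
finite suprema bound all values. This supplies the boundedness that real suprema need in the
contraction argument. -/
theorem unifBdd_of_empRademacher (hN : 0 < N) {G : Set (X → ℝ)} (hG : G.Nonempty) {S : Fin N → X}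
    (h : empRademacher G S ≠ ⊤) : UnifBdd fun (g : G) i => (g : X → ℝ) (S i) := by
  have hN' : (0 : ℝ) < N := Nat.cast_pos.2 hN
  refine ⟨N * ∑ σ : Fin N → Bool, |(weightedSup G (fun i => sign (σ i) / N) S).toReal|,
    fun g i => ?_⟩
  let σ : Fin N → Bool := fun j => decide (0 ≤ (g : X → ℝ) (S j))
  have hσ : ∀ j, sign (σ j) / N * (g : X → ℝ) (S j) = |(g : X → ℝ) (S j)| / N := fun j => by
    by_cases hj : 0 ≤ (g : X → ℝ) (S j)
    · simp [σ, sign, hj, abs_of_nonneg]; ring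
    · simp [σ, sign, hj, abs_of_neg (not_le.1 hj)]; ring
  have h1 : ((∑ j, sign (σ j) / N * (g : X → ℝ) (S j) : ℝ) : EReal) ≤
      weightedSup G (fun j => sign (σ j) / N) S :=
    le_iSup₂ (f := fun (g : X → ℝ) (_ : g ∈ G) =>
      ((∑ j, sign (σ j) / N * g (S j) : ℝ) : EReal)) g.1 g.2
  rw [← EReal.coe_toReal (weightedSup_ne_top_of_empRademacher hG h σ)
    (weightedSup_ne_bot hG _ S), EReal.coe_le_coe_iff] at h1
  simp only [hσ] at h1
  have h2 : |(g : X → ℝ) (S i)| / N ≤ ∑ j, |(g : X → ℝ) (S j)| / N :=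
    Finset.single_le_sum (f := fun j => |(g : X → ℝ) (S j)| / N) (fun j _ => by positivity)
      (Finset.mem_univ i)
  have h3 := Finset.single_le_sum
    (f := fun σ : Fin N → Bool => |(weightedSup G (fun i => sign (σ i) / N) S).toReal|)
    (fun σ _ => abs_nonneg _) (Finset.mem_univ σ)
  have h4 := (h2.trans h1).trans ((le_abs_self _).trans h3)
  rw [div_le_iff₀ hN'] at h4
  linarith

theorem signSup_le_empRademacher (hN : 0 < N) {G : Set (X → ℝ)} (hG : G.Nonempty) {S : Fin N → X}
    (h : empRademacher G S ≠ ⊤) :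
    signSup (fun (g : G) i => (g : X → ℝ) (S i)) ≤ N * 2 ^ N * (empRademacher G S).toReal := by
  have hN' : (0 : ℝ) < N := Nat.cast_pos.2 hN
  have : Nonempty G := hG.to_subtype
  have hb := unifBdd_of_empRademacher hN hG h
  have hw : ∀ σ : Fin N → Bool, weightedSup G (fun i => sign (σ i) / N) S =
      ((N : ℝ)⁻¹ * ⨆ g : G, ∑ i, sign (σ i) * (g : X → ℝ) (S i) : ℝ) := fun σ => by
    have := weightedSup_range (fun g : G => (g : X → ℝ)) (fun i => sign (σ i) / N) S
      (hb.bddAbove _)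
    rw [Subtype.range_coe] at this
    rw [this, indexedSup, Real.mul_iSup_of_nonneg (by positivity)]
    congr 2
    ext g
    rw [Finset.mul_sum]
    exact Finset.sum_congr rfl fun i _ => by ring
  have hsum : (((2 : ℝ) ^ N)⁻¹ : ℝ) *
      ∑ σ : Fin N → Bool, weightedSup G (fun i => sign (σ i) / N) S =
      (((2 : ℝ) ^ N)⁻¹ * ((N : ℝ)⁻¹ * signSup fun (g : G) i => (g : X → ℝ) (S i)) : ℝ) := by
    rw [signSup, Finset.mul_sum, EReal.coe_mul, EReal_coe_sum]
    simp only [hw]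
  rw [empRademacher, hsum, EReal.toENNReal_of_ne_top (EReal.coe_ne_top _), EReal.toReal_coe,
    ENNReal.toReal_ofReal']
  refine le_trans (le_of_eq ?_) (mul_le_mul_of_nonneg_left (le_max_left _ _) (by positivity))
  field_simp

end

/-! ### The margin loss and the factor K/(2ρ). -/

section

variable {X : Type*} {K : ℕ}

theorem marginLoss_mem_Icc (ρ t : ℝ) : marginLoss ρ t ∈ Set.Icc (0 : ℝ) 1 :=
  ⟨le_min zero_le_one (le_max_left _ _), min_le_left _ _⟩

theorem marginLoss_lipschitz {ρ : ℝ} (hρ : 0 < ρ) (a b : ℝ) :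
    |marginLoss ρ a - marginLoss ρ b| ≤ 1 / ρ * |a - b| := by
  rw [marginLoss, marginLoss, min_comm, min_comm (1 : ℝ), max_comm, max_comm (0 : ℝ)]
  have h1 := abs_min_sub_min_le_max (max (1 - a / ρ) 0) 1 (max (1 - b / ρ) 0) 1
  rw [sub_self, abs_zero, max_eq_left (a := |_|) (abs_nonneg _)] at h1
  refine h1.trans ((abs_max_sub_max_le_abs _ _ _).trans (le_of_eq ?_))
  rw [show 1 - a / ρ - (1 - b / ρ) = 1 / ρ * (b - a) by ring, abs_mul, abs_sub_comm b,
    abs_of_pos (by positivity)]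

/-- Competing labels are written as cyclic shifts y + j, so the index set no longer depends on y.
With y = h(x), each shift is a relabelling of h and stays in H. -/
theorem margin_eq_iSup_add [NeZero K] (f : X → Fin K → ℝ) (x : X) (y : Fin K) :
    margin f x y = (f x y - ⨆ j : {j : Fin K // j ≠ 0}, f x (y + j)) / 2 := by
  rw [margin]
  let e : {j : Fin K // j ≠ 0} ≃ {y' : Fin K // y' ≠ y} :=
    (Equiv.addLeft y).subtypeEquiv fun j => by simp
  rw [← e.iSup_comp]
  rfl

theorem signSup_marginLoss_le {N : ℕ} (hK : 2 ≤ K) {ρ : ℝ} (hρ : 0 < ρ)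
    {F : Set (X → Fin K → ℝ)} (hF : F.Nonempty) {H : Set (X → Fin K)}
    (sel : (Fin K → ℝ) → Fin K) (hFH : ∀ f ∈ F, induced sel f ∈ H)
    (hH : ∀ h ∈ H, ∀ τ : Equiv.Perm (Fin K), (fun x => τ (h x)) ∈ H) {S : Fin N → X}
    (hb : UnifBdd fun (g : piClass H F) i => (g : X → ℝ) (S i)) :
    signSup (fun (p : F × F) i =>
        marginLoss ρ (margin p.1 (S i) (induced sel p.2 (S i)))) ≤
      K / (2 * ρ) * signSup fun (g : piClass H F) i => (g : X → ℝ) (S i) := by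
  have : NeZero K := ⟨by omega⟩
  have : Nontrivial (Fin K) := Fin.nontrivial_iff_two_le.2 hK
  have : Nonempty F := hF.to_subtype
  obtain ⟨j₀, hj₀⟩ := exists_ne (0 : Fin K)
  have : Nonempty {j : Fin K // j ≠ 0} := ⟨⟨j₀, hj₀⟩⟩
  let π : Fin K → F × F → piClass H F := fun j p =>
    ⟨fun x => p.1.1 x (induced sel p.2 x + j), _,
      hH _ (hFH p.2 p.2.2) (Equiv.addRight j), p.1.1, p.1.2, rfl⟩
  let v : Fin K → F × F → Fin N → ℝ := fun j p i => (π j p : X → ℝ) (S i)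
  have hv : ∀ j, UnifBdd (v j) := fun j => by
    obtain ⟨B, hB⟩ := hb
    exact ⟨B, fun p i => hB (π j p) i⟩
  set R := signSup fun (g : piClass H F) i => (g : X → ℝ) (S i) with hR
  have hvR : ∀ j, signSup (v j) ≤ R := fun j => signSup_comp_le hb (π j)
  have hne : (Finset.univ : Finset {j : Fin K // j ≠ 0}).Nonempty := Finset.univ_nonempty
  obtain ⟨hmb, hml⟩ := signSup_sup'_le (fun j : {j : Fin K // j ≠ 0} => hv j) hne
  -- The K-1 nonzero shifts; shift 0 adds one more R below.
  have hcard : ∑ j : {j : Fin K // j ≠ 0}, signSup (v j) ≤ (K - 1) * R := by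
    refine (Finset.sum_le_sum (f := fun j : {j : Fin K // j ≠ 0} => signSup (v j)) (g := fun _ => R)
      (s := Finset.univ) fun j _ => hvR j).trans (le_of_eq ?_)
    rw [Finset.sum_const, Finset.card_univ, Fintype.card_subtype_compl, nsmul_eq_mul]
    simp [Nat.cast_sub (by omega : 1 ≤ K)]
  have hadd := signSup_add_le (hv 0) hmb.neg
  rw [signSup_neg] at hadd
  have hmb' := ((hv 0).add hmb.neg).const_mul (1 / 2)
  have heq : ∀ (p : F × F) i, margin p.1 (S i) (induced sel p.2 (S i)) =
      1 / 2 * (v 0 p i + -Finset.univ.sup' hne fun j : {j : Fin K // j ≠ 0} => v j p i) := by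
    intro p i
    rw [margin_eq_iSup_add, Finset.sup'_univ_eq_ciSup]
    simp [v, π]
    ring
  have hlip := signSup_lipschitz_le hmb' (by positivity) (marginLoss_lipschitz hρ)
  rw [signSup_const_mul (by norm_num)] at hlip
  simp only [heq]
  refine hlip.trans ?_
  have h0 := hvR 0
  have : signSup (fun p i => v 0 p i +
      -Finset.univ.sup' hne fun j : {j : Fin K // j ≠ 0} => v j p i) ≤ K * R := by linarith
  calc _ ≤ 1 / ρ * (1 / 2 * (K * R)) := by gcongr
    _ = _ := by field_simp

end

/-! ### Disparities, empirical measures and uniform deviations. -/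

section

open ProbabilityTheory

variable {X : Type*} {K : ℕ}

/-- The loss `Φ_ρ(ρ_{f'}(x, h_f(x)))` of a pair of scoring functions. -/
noncomputable def pairLoss (sel : (Fin K → ℝ) → Fin K) (ρ : ℝ) (f' f : X → Fin K → ℝ) (x : X) : ℝ :=
  marginLoss ρ (margin f' x (induced sel f x))

theorem pairLoss_mem_Icc (sel : (Fin K → ℝ) → Fin K) (ρ : ℝ) (f' f : X → Fin K → ℝ) (x : X) :
    pairLoss sel ρ f' f x ∈ Set.Icc (0 : ℝ) 1 :=
  marginLoss_mem_Icc _ _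

variable [MeasurableSpace X]

theorem measurable_margin {f : X → Fin K → ℝ} (hf : Measurable f) (y : Fin K) :
    Measurable fun x => margin f x y := by
  have h : ∀ y, Measurable fun x => f x y := measurable_pi_iff.1 hf
  simp only [margin]
  exact ((h y).sub (Measurable.iSup fun y' : {y' : Fin K // y' ≠ y} => h y')).div_const 2

theorem measurable_marginLoss (ρ : ℝ) : Measurable (marginLoss ρ) := by
  unfold marginLoss
  fun_prop

theorem measurable_pairLoss {sel : (Fin K → ℝ) → Fin K} (hselm : Measurable sel) (ρ : ℝ)
    {f' f : X → Fin K → ℝ} (hf' : Measurable f') (hf : Measurable f) :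
    Measurable (pairLoss sel ρ f' f) := by
  have h : Measurable fun z : X × Fin K => margin f' z.1 z.2 :=
    measurable_from_prod_countable_left fun y => measurable_margin hf' y
  exact (measurable_marginLoss ρ).comp (h.comp (measurable_id.prodMk (hselm.comp hf)))

theorem disp_mem_Icc (sel : (Fin K → ℝ) → Fin K) (ρ : ℝ) (Q : Measure X) [IsProbabilityMeasure Q]
    (f' f : X → Fin K → ℝ) : disp sel ρ Q f' f ∈ Set.Icc (0 : ℝ) 1 := by
  refine ⟨integral_nonneg fun x => (pairLoss_mem_Icc sel ρ f' f x).1, ?_⟩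
  have h := integral_mono_of_nonneg (μ := Q)
    (ae_of_all _ fun x => (pairLoss_mem_Icc sel ρ f' f x).1) (integrable_const (1 : ℝ))
    (ae_of_all _ fun x => (pairLoss_mem_Icc sel ρ f' f x).2)
  simp only [integral_const, probReal_univ, one_smul] at h
  exact h

theorem isProbabilityMeasure_empirical {N : ℕ} (hN : 0 < N) (S : Fin N → X) :
    IsProbabilityMeasure (empirical S) := by
  constructor
  simp [empirical, ENNReal.inv_mul_cancel (Nat.cast_ne_zero.2 hN.ne') (ENNReal.natCast_ne_top N)]

theorem integral_empirical {N : ℕ} (S : Fin N → X) {g : X → ℝ} (hg : Measurable g) :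
    ∫ x, g x ∂(empirical S) = (N : ℝ)⁻¹ * ∑ i, g (S i) := by
  have hi : ∀ i, Integrable g (Measure.dirac (S i)) := fun i =>
    integrable_dirac' hg.stronglyMeasurable (by simp)
  rw [empirical, integral_smul_measure, integral_finsetSum_measure fun i _ => hi i]
  simp [integral_dirac' _ _ hg.stronglyMeasurable]

/-- The centred loss of a pair of scoring functions. -/
noncomputable def centeredLoss (sel : (Fin K → ℝ) → Fin K) (ρ : ℝ) (F : Set (X → Fin K → ℝ)) (D : Measure X)
    (p : F × F) (x : X) : ℝ :=
  pairLoss sel ρ p.1 p.2 x - disp sel ρ D p.1 p.2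

theorem centeredLossClass_eq_range (sel : (Fin K → ℝ) → Fin K) (ρ : ℝ)
    (F : Set (X → Fin K → ℝ)) (D : Measure X) :
    centeredLossClass sel ρ F D = Set.range (centeredLoss sel ρ F D) := by
  ext g
  constructor
  · rintro ⟨f', hf', f, hf, rfl⟩
    exact ⟨(⟨f', hf'⟩, ⟨f, hf⟩), rfl⟩
  · rintro ⟨⟨f', f⟩, rfl⟩
    exact ⟨f', f'.2, f, f.2, rfl⟩

variable {sel : (Fin K → ℝ) → Fin K} {ρ : ℝ} {F : Set (X → Fin K → ℝ)} {H : Set (X → Fin K)}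
  {D : Measure X}

theorem abs_centeredLoss_le [IsProbabilityMeasure D] (p : F × F) (x : X) : |centeredLoss sel ρ F D p x| ≤ 1 := by
  have h1 := pairLoss_mem_Icc sel ρ p.1.1 p.2.1 x
  have h2 := disp_mem_Icc sel ρ D p.1.1 p.2.1
  rw [centeredLoss, abs_le]
  exact ⟨by linarith [h1.1, h2.2], by linarith [h1.2, h2.1]⟩

theorem disp_empirical_sub (hselm : Measurable sel) (hF : ∀ f ∈ F, Measurable f) {N : ℕ}
    (hN : 0 < N) (S : Fin N → X) (p : F × F) :
    disp sel ρ (empirical S) p.1 p.2 - disp sel ρ D p.1 p.2 =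
      ∑ i, (N : ℝ)⁻¹ * centeredLoss sel ρ F D p (S i) := by
  have hN' : (N : ℝ) ≠ 0 := Nat.cast_ne_zero.2 hN.ne'
  have h := integral_empirical S
    (measurable_pairLoss hselm ρ (hF p.1 p.1.2) (hF p.2 p.2.2))
  change ∫ x, pairLoss sel ρ p.1 p.2 x ∂(empirical S) - _ = _
  rw [h, ← Finset.mul_sum]
  simp only [centeredLoss, Finset.sum_sub_distrib, Finset.sum_const, Finset.card_univ,
    Fintype.card_fin, nsmul_eq_mul]
  field_simp

theorem aemeasurable_empRademacher {G : Set (X → ℝ)} (hG : IsMeasurableClass D G) (N : ℕ) :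
    AEMeasurable (empRademacher (N := N) G) (sampleLaw N D) :=
  ((Finset.aemeasurable_fun_sum _ fun _ _ => hG N _).const_mul _).ereal_toENNReal

variable [IsProbabilityMeasure D]

theorem disp_empirical_sub_le (hselm : Measurable sel) (hF : ∀ f ∈ F, Measurable f) {N : ℕ}
    (hN : 0 < N) (S : Fin N → X) (p : F × F) :
    disp sel ρ (empirical S) p.1 p.2 - disp sel ρ D p.1 p.2 ≤
      indexedSup (centeredLoss sel ρ F D) (fun _ => (N : ℝ)⁻¹) S := by
  rw [disp_empirical_sub hselm hF hN]
  exact le_ciSup (bddAbove_indexedSup (abs_centeredLoss_le (D := D)) (fun _ => (N : ℝ)⁻¹) S) p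

theorem sub_disp_empirical_le (hselm : Measurable sel) (hF : ∀ f ∈ F, Measurable f) {N : ℕ}
    (hN : 0 < N) (S : Fin N → X) (p : F × F) :
    disp sel ρ D p.1 p.2 - disp sel ρ (empirical S) p.1 p.2 ≤
      indexedSup (centeredLoss sel ρ F D) (fun _ => -(N : ℝ)⁻¹) S := by
  have h := disp_empirical_sub (ρ := ρ) (D := D) hselm hF hN S p
  have h' := le_ciSup
    (bddAbove_indexedSup (abs_centeredLoss_le (sel := sel) (ρ := ρ) (F := F) (D := D))
      (fun _ => -(N : ℝ)⁻¹) S) p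
  simp only [neg_mul, Finset.sum_neg_distrib] at h'
  rw [← neg_sub, h]
  simpa only [indexedSup, neg_mul, Finset.sum_neg_distrib] using h'

/-- Only the primed measures need be probability measures: the supremum on the right must be bounded
above, while the one on the left is estimated termwise. -/
theorem mdd_le_add {f : X → Fin K → ℝ} (hf : f ∈ F) {Q₁ Q₂ Q₁' Q₂' : Measure X}
    [IsProbabilityMeasure Q₁'] [IsProbabilityMeasure Q₂'] {x y : ℝ}
    (hx : ∀ f' ∈ F, disp sel ρ Q₁' f' f - disp sel ρ Q₁ f' f ≤ x)
    (hy : ∀ f' ∈ F, disp sel ρ Q₂ f' f - disp sel ρ Q₂' f' f ≤ y) :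
    mdd sel ρ F f Q₁ Q₂ ≤ mdd sel ρ F f Q₁' Q₂' + (x + y) := by
  have : Nonempty F := ⟨⟨f, hf⟩⟩
  refine ciSup_le fun f' => ?_
  have hb : BddAbove (Set.range fun f' : F => disp sel ρ Q₂' f' f - disp sel ρ Q₁' f' f) := by
    refine ⟨1, ?_⟩
    rintro _ ⟨f', rfl⟩
    have h1 := (disp_mem_Icc sel ρ Q₂' f' f).2
    have h2 := (disp_mem_Icc sel ρ Q₁' f' f).1
    beta_reduce
    linarith
  have h := le_ciSup hb f'
  have h1 := hx f' f'.2
  have h2 := hy f' f'.2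
  rw [mdd]
  beta_reduce at h
  linarith

/-- The deviation of the empirical proxy margin discrepancy in terms of uniform deviations. -/
theorem abs_pmd_sub_le (hselm : Measurable sel) (hF : ∀ f ∈ F, Measurable f)
    {Qn Q' P : Measure X} [IsProbabilityMeasure Qn] [IsProbabilityMeasure Q']
    [IsProbabilityMeasure P] {m u n : ℕ} (hm : 0 < m) (hu : 0 < u) (hn : 0 < n)
    (S : Fin m → X) (U : Fin u → X) (V : Fin n → X) {f : X → Fin K → ℝ} (hf : f ∈ F) {C : ℝ}
    (h1 : indexedSup (centeredLoss sel ρ F Qn) (fun _ => -(m : ℝ)⁻¹) S +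
      (indexedSup (centeredLoss sel ρ F Q') (fun _ => (u : ℝ)⁻¹) U +
        indexedSup (centeredLoss sel ρ F Q') (fun _ => -(u : ℝ)⁻¹) U +
        indexedSup (centeredLoss sel ρ F P) (fun _ => (n : ℝ)⁻¹) V) ≤ C)
    (h2 : indexedSup (centeredLoss sel ρ F Qn) (fun _ => (m : ℝ)⁻¹) S +
      (indexedSup (centeredLoss sel ρ F Q') (fun _ => (u : ℝ)⁻¹) U +
        indexedSup (centeredLoss sel ρ F Q') (fun _ => -(u : ℝ)⁻¹) U +
        indexedSup (centeredLoss sel ρ F P) (fun _ => -(n : ℝ)⁻¹) V) ≤ C) :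
    |pmd sel ρ F f (empirical S) (empirical U) (empirical V) - pmd sel ρ F f Qn Q' P| ≤ C := by
  have := isProbabilityMeasure_empirical hm S
  have := isProbabilityMeasure_empirical hu U
  have := isProbabilityMeasure_empirical hn V
  have up : ∀ {D : Measure X} [IsProbabilityMeasure D] {N : ℕ} (hN : 0 < N) (S : Fin N → X),
      ∀ f' ∈ F, disp sel ρ (empirical S) f' f - disp sel ρ D f' f ≤
        indexedSup (centeredLoss sel ρ F D) (fun _ => (N : ℝ)⁻¹) S := by
    intro D _ N hN S f' hf'
    exact disp_empirical_sub_le hselm hF hN S (⟨f', hf'⟩, ⟨f, hf⟩)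
  have down : ∀ {D : Measure X} [IsProbabilityMeasure D] {N : ℕ} (hN : 0 < N) (S : Fin N → X),
      ∀ f' ∈ F, disp sel ρ D f' f - disp sel ρ (empirical S) f' f ≤
        indexedSup (centeredLoss sel ρ F D) (fun _ => -(N : ℝ)⁻¹) S := by
    intro D _ N hN S f' hf'
    exact sub_disp_empirical_le hselm hF hN S (⟨f', hf'⟩, ⟨f, hf⟩)
  have a1 := mdd_le_add hf (down (D := Qn) hm S) (up (D := Q') hu U)
  have a2 := mdd_le_add hf (down (D := Q') hu U) (up (D := P) hn V)
  have b1 := mdd_le_add hf (up (D := Qn) hm S) (down (D := Q') hu U)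
  have b2 := mdd_le_add hf (up (D := Q') hu U) (down (D := P) hn V)
  rw [pmd, pmd, abs_le]
  exact ⟨by linarith, by linarith⟩

theorem aemeasurable_indexedSup_centeredLoss (hF0 : F.Nonempty)
    (hc : IsMeasurableClass D (centeredLossClass sel ρ F D)) {N : ℕ} (a : Fin N → ℝ) :
    AEMeasurable (indexedSup (centeredLoss sel ρ F D) a) (sampleLaw N D) := by
  have : Nonempty F := hF0.to_subtype
  refine (hc N a).ereal_toReal.congr (ae_of_all _ fun S => ?_)
  beta_reduce
  rw [centeredLossClass_eq_range, weightedSup_range _ _ _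
    (bddAbove_indexedSup (abs_centeredLoss_le (D := D)) a S), EReal.toReal_coe]

/-- The expected uniform deviation is controlled by the Rademacher complexity of `Π_H F`. -/
theorem integral_indexedSup_centeredLoss_le (hK : 2 ≤ K) (hselm : Measurable sel) (hρ : 0 < ρ)
    (hF0 : F.Nonempty) (hF : ∀ f ∈ F, Measurable f) (hFH : ∀ f ∈ F, induced sel f ∈ H)
    (hH : ∀ h ∈ H, ∀ τ : Equiv.Perm (Fin K), (fun x => τ (h x)) ∈ H)
    (hG : IsMeasurableClass D (piClass H F))
    (hc : IsMeasurableClass D (centeredLossClass sel ρ F D)) {N : ℕ} (hN : 0 < N)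
    (hR : rademacher N D (piClass H F) ≠ ⊤) {w : ℝ} (hw : |w| = (N : ℝ)⁻¹) :
    ∫ S, indexedSup (centeredLoss sel ρ F D) (fun _ => w) S ∂(sampleLaw N D) ≤
      K / ρ * (rademacher N D (piClass H F)).toReal := by
  have hN' : (0 : ℝ) < N := Nat.cast_pos.2 hN
  have hGne : (piClass H F).Nonempty := by
    obtain ⟨f, hf⟩ := hF0
    exact ⟨_, _, hFH f hf, f, hf, rfl⟩
  have hem := aemeasurable_empRademacher hG N
  have hfin : ∀ᵐ S ∂(sampleLaw N D), empRademacher (piClass H F) S < ⊤ := ae_lt_top' hem hR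
  have hri := integrable_toReal_of_lintegral_ne_top hem hR
  have hint : ∫ S, (empRademacher (piClass H F) S).toReal ∂(sampleLaw N D) =
      (rademacher N D (piClass H F)).toReal := integral_toReal hem hfin
  have : Nonempty F := hF0.to_subtype
  -- The measurability hypothesis at sample size N + N, needed for the doubled sample.
  have hm2 : AEMeasurable (indexedSup (centeredLoss sel ρ F D)
      (Sum.elim (fun _ : Fin N => w) fun _ : Fin N => -w))
      (Measure.pi fun _ : Fin N ⊕ Fin N => D) := by
    have h := aemeasurable_indexedSup_comp (D := D) finSumFinEquiv
      (aemeasurable_indexedSup_centeredLoss hF0 hc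
        (Sum.elim (fun _ : Fin N => w) (fun _ : Fin N => -w) ∘ finSumFinEquiv.symm))
    rwa [Function.comp_assoc, Equiv.symm_comp_self, Function.comp_id] at h
  have key := integral_indexedSup_le (ι := Fin N) (D := D)
    (g := fun (p : F × F) x => pairLoss sel ρ p.1 p.2 x)
    (c := centeredLoss sel ρ F D) (b := fun p => disp sel ρ D p.1 p.2) (B := 1)
    (fun p x => by
      have h := pairLoss_mem_Icc sel ρ p.1.1 p.2.1 x
      rw [abs_of_nonneg h.1]; exact h.2)
    abs_centeredLoss_le
    (fun p => (measurable_pairLoss hselm ρ (hF p.1 p.1.2) (hF p.2 p.2.2)).sub_const _)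
    (fun p x => rfl)
    (fun p => by
      have hi : Integrable (pairLoss sel ρ p.1.1 p.2.1) D :=
        Integrable.of_mem_Icc 0 1
          (measurable_pairLoss hselm ρ (hF p.1 p.1.2) (hF p.2 p.2.2)).aemeasurable
          (ae_of_all _ fun x => pairLoss_mem_Icc sel ρ p.1.1 p.2.1 x)
      have h := integral_sub hi (integrable_const (disp sel ρ D p.1 p.2))
      simp only [integral_const, probReal_univ, one_smul] at h
      exact h.trans (sub_self _))
    w (aemeasurable_indexedSup_centeredLoss hF0 hc fun _ => w) hm2
    (hri.const_mul (K / (2 * ρ)))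
    (by
      -- Contraction needs values bounded on the sample, which holds wherever the empirical
      -- complexity is finite, hence almost everywhere.
      filter_upwards [hfin] with S hS
      have h1 := unifBdd_of_empRademacher hN hGne hS.ne
      have h2 := signSup_le_empRademacher hN hGne hS.ne
      have h3 := signSup_marginLoss_le hK hρ hF0 sel hFH hH h1
      have h4 := h3.trans (mul_le_mul_of_nonneg_left h2 (by positivity))
      rw [hw, Fintype.card_fin]
      refine (mul_le_mul_of_nonneg_left h4 (by positivity)).trans (le_of_eq ?_)
      field_simp)
  refine key.trans (le_of_eq ?_)
  rw [integral_const_mul]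
  change 2 * (K / (2 * ρ) * ∫ S, (empRademacher (piClass H F) S).toReal ∂(sampleLaw N D)) = _
  rw [hint]
  field_simp

/-- The centring cancels in the difference of the old and new terms, and losses lie in [0, 1];
bounding the centred losses separately by 1 would give 2|w|. -/
theorem indexedSup_centeredLoss_update_le (hF0 : F.Nonempty) {N : ℕ} (w : ℝ) (S : Fin N → X)
    (i : Fin N) (x : X) :
    indexedSup (centeredLoss sel ρ F D) (fun _ => w) (Function.update S i x) ≤
      indexedSup (centeredLoss sel ρ F D) (fun _ => w) S + |w| := by
  have : Nonempty F := hF0.to_subtype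
  refine ciSup_le fun p => ?_
  have h := le_ciSup (bddAbove_indexedSup
    (abs_centeredLoss_le (sel := sel) (ρ := ρ) (F := F) (D := D)) (fun _ => w) S) p
  beta_reduce at h
  rw [← Finset.sum_erase_add _ _ (Finset.mem_univ i)] at h ⊢
  rw [Function.update_self, Finset.sum_congr rfl fun j hj => by
    rw [Function.update_of_ne (Finset.ne_of_mem_erase hj)]]
  have h1 := pairLoss_mem_Icc sel ρ p.1.1 p.2.1 x
  have h2 := pairLoss_mem_Icc sel ρ p.1.1 p.2.1 (S i)
  have h3 : w * centeredLoss sel ρ F D p x - w * centeredLoss sel ρ F D p (S i) ≤ |w| := by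
    rw [← mul_sub]
    refine (le_abs_self _).trans ?_
    rw [abs_mul]
    refine mul_le_of_le_one_right (abs_nonneg _) ?_
    rw [centeredLoss, centeredLoss, abs_le]
    exact ⟨by linarith [h1.1, h2.2], by linarith [h1.2, h2.1]⟩
  rw [indexedSup]
  linarith

end

/-! ### Joint concentration for the three samples. -/

section

open ProbabilityTheory

theorem hasSubgaussianMGF_add_prod {α β : Type*} [MeasurableSpace α] [MeasurableSpace β]
    {μ : Measure α} {ν : Measure β} [IsProbabilityMeasure μ] [IsProbabilityMeasure ν]
    {f : α → ℝ} {g : β → ℝ} {v w : NNReal} (hf : HasSubgaussianMGF f v μ)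
    (hg : HasSubgaussianMGF g w ν) :
    HasSubgaussianMGF (fun z => f z.1 + g z.2) (v + w) (μ.prod ν) := by
  have h1 : HasSubgaussianMGF (f ∘ Prod.fst) v (μ.prod ν) :=
    .of_map measurable_fst.aemeasurable (by rwa [Measure.map_fst_prod, measure_univ, one_smul])
  have h2 : HasSubgaussianMGF (g ∘ Prod.snd) w (μ.prod ν) :=
    .of_map measurable_snd.aemeasurable (by rwa [Measure.map_snd_prod, measure_univ, one_smul])
  exact h1.add_of_indepFun h2 (indepFun_prod₀ hf.aemeasurable hg.aemeasurable)

variable {X : Type*} [MeasurableSpace X] {K : ℕ} {sel : (Fin K → ℝ) → Fin K} {ρ : ℝ}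
  {F : Set (X → Fin K → ℝ)} {D : Measure X} [IsProbabilityMeasure D]

theorem hasSubgaussianMGF_indexedSup (hF0 : F.Nonempty)
    (hc : IsMeasurableClass D (centeredLossClass sel ρ F D)) {N : ℕ} (hN : 0 < N) {w : ℝ}
    (hw : |w| = (N : ℝ)⁻¹) :
    HasSubgaussianMGF (fun S => indexedSup (centeredLoss sel ρ F D) (fun _ => w) S -
      ∫ S, indexedSup (centeredLoss sel ρ F D) (fun _ => w) S ∂(sampleLaw N D))
      ((4 * N : NNReal)⁻¹) (sampleLaw N D) := by
  have : Nonempty F := hF0.to_subtype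
  have h := hasSubgaussianMGF_of_bounded_differences D (c := (N : NNReal)⁻¹) N
    (aemeasurable_indexedSup_centeredLoss hF0 hc fun _ => w)
    (fun S => abs_indexedSup_le abs_centeredLoss_le _ S) fun S i x => by
      have := indexedSup_centeredLoss_update_le (sel := sel) (ρ := ρ) (D := D) hF0 w S i x
      rw [hw] at this
      simpa using this
  have hN' : (N : NNReal) ≠ 0 := Nat.cast_ne_zero.2 hN.ne'
  convert h using 1
  field_simp
  norm_num

/-- For the proxy: both deviations depend on the same sample, so their sum is treated as one
function with differences 2/N, giving the proxy N (1/N)² = 1/N. -/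
theorem hasSubgaussianMGF_indexedSup_add (hF0 : F.Nonempty)
    (hc : IsMeasurableClass D (centeredLossClass sel ρ F D)) {N : ℕ} (hN : 0 < N) {w w' : ℝ}
    (hw : |w| = (N : ℝ)⁻¹) (hw' : |w'| = (N : ℝ)⁻¹) :
    HasSubgaussianMGF (fun S => indexedSup (centeredLoss sel ρ F D) (fun _ => w) S +
        indexedSup (centeredLoss sel ρ F D) (fun _ => w') S -
      (∫ S, indexedSup (centeredLoss sel ρ F D) (fun _ => w) S ∂(sampleLaw N D) +
        ∫ S, indexedSup (centeredLoss sel ρ F D) (fun _ => w') S ∂(sampleLaw N D)))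
      ((N : NNReal)⁻¹) (sampleLaw N D) := by
  have : Nonempty F := hF0.to_subtype
  have hm := aemeasurable_indexedSup_centeredLoss hF0 hc fun _ : Fin N => w
  have hm' := aemeasurable_indexedSup_centeredLoss hF0 hc fun _ : Fin N => w'
  have hb := fun S => abs_indexedSup_le
    (abs_centeredLoss_le (sel := sel) (ρ := ρ) (F := F) (D := D)) (fun _ : Fin N => w) S
  have hb' := fun S => abs_indexedSup_le
    (abs_centeredLoss_le (sel := sel) (ρ := ρ) (F := F) (D := D)) (fun _ : Fin N => w') S
  have h := hasSubgaussianMGF_of_bounded_differences D (c := 2 * (N : NNReal)⁻¹) N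
    (hm.add hm') (fun S => (abs_add_le _ _).trans (add_le_add (hb S) (hb' S))) fun S i x => by
      have h1 := indexedSup_centeredLoss_update_le (sel := sel) (ρ := ρ) (D := D) hF0 w S i x
      have h2 := indexedSup_centeredLoss_update_le (sel := sel) (ρ := ρ) (D := D) hF0 w' S i x
      rw [hw] at h1
      rw [hw'] at h2
      push_cast
      simp only [Pi.add_apply]
      linarith
  have hE := integral_add (integrable_of_abs_le hm hb) (integrable_of_abs_le hm' hb')
  have hN' : (N : NNReal) ≠ 0 := Nat.cast_ne_zero.2 hN.ne'
  convert h using 1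
  · simp only [Pi.add_apply]
    rw [hE]
  · field_simp

/-- One-sided tail bound for the sum of the uniform deviations of the three samples. -/
theorem measure_indexedSup_add_ge_le (hF0 : F.Nonempty) {Qn Q' P : Measure X}
    [IsProbabilityMeasure Qn] [IsProbabilityMeasure Q'] [IsProbabilityMeasure P]
    (hQn : IsMeasurableClass Qn (centeredLossClass sel ρ F Qn))
    (hQ' : IsMeasurableClass Q' (centeredLossClass sel ρ F Q'))
    (hP : IsMeasurableClass P (centeredLossClass sel ρ F P))
    {m u n : ℕ} (hm : 0 < m) (hu : 0 < u) (hn : 0 < n) {w₁ w₂ w₃ : ℝ}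
    (hw₁ : |w₁| = (m : ℝ)⁻¹) (hw₂ : |w₂| = (u : ℝ)⁻¹) (hw₃ : |w₃| = (n : ℝ)⁻¹)
    {E₁ E₂ E₃ : ℝ}
    (hE₁ : ∫ S, indexedSup (centeredLoss sel ρ F Qn) (fun _ => w₁) S ∂(sampleLaw m Qn) ≤ E₁)
    (hE₂ : ∫ S, indexedSup (centeredLoss sel ρ F Q') (fun _ => w₂) S ∂(sampleLaw u Q') ≤ E₂)
    (hE₂' : ∫ S, indexedSup (centeredLoss sel ρ F Q') (fun _ => -w₂) S ∂(sampleLaw u Q') ≤ E₂)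
    (hE₃ : ∫ S, indexedSup (centeredLoss sel ρ F P) (fun _ => w₃) S ∂(sampleLaw n P) ≤ E₃)
    {δ : ℝ} (hδ : 0 < δ) (hδ2 : δ ≤ 2) :
    ((sampleLaw m Qn).prod ((sampleLaw u Q').prod (sampleLaw n P)))
      {S | E₁ + 2 * E₂ + E₃ + (√(Real.log (2 / δ) / (2 * m)) + 2 * √(Real.log (2 / δ) / (2 * u))
            + √(Real.log (2 / δ) / (2 * n))) ≤
          indexedSup (centeredLoss sel ρ F Qn) (fun _ => w₁) S.1 +
            (indexedSup (centeredLoss sel ρ F Q') (fun _ => w₂) S.2.1 +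
              indexedSup (centeredLoss sel ρ F Q') (fun _ => -w₂) S.2.1 +
              indexedSup (centeredLoss sel ρ F P) (fun _ => w₃) S.2.2)} ≤
      ENNReal.ofReal (δ / 2) := by
  have hm' : (0 : ℝ) < m := Nat.cast_pos.2 hm
  have hu' : (0 : ℝ) < u := Nat.cast_pos.2 hu
  have hn' : (0 : ℝ) < n := Nat.cast_pos.2 hn
  have hL : 0 ≤ Real.log (2 / δ) := Real.log_nonneg (by rwa [le_div_iff₀ hδ, one_mul])
  have hsub := hasSubgaussianMGF_add_prod (hasSubgaussianMGF_indexedSup hF0 hQn hm hw₁)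
    (hasSubgaussianMGF_add_prod
      (hasSubgaussianMGF_indexedSup_add hF0 hQ' hu hw₂ ((abs_neg w₂).trans hw₂))
      (hasSubgaussianMGF_indexedSup hF0 hP hn hw₃))
  set L := Real.log (2 / δ) with hLdef
  set ε := √(L / (2 * m)) + 2 * √(L / (2 * u)) + √(L / (2 * n)) with hε
  have hε0 : 0 ≤ ε := by positivity
  have htail := hsub.measure_ge_le hε0
  rw [← ENNReal.ofReal_toReal (measure_ne_top _ _)]
  refine ENNReal.ofReal_le_ofReal ?_
  refine (measureReal_mono (fun S hS => ?_) (measure_ne_top _ _)).trans (htail.trans ?_)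
  · simp only [Set.mem_ofPred_eq] at hS ⊢
    linarith
  · have ha := Real.sq_sqrt (div_nonneg hL (by positivity : (0 : ℝ) ≤ 2 * m))
    have hb := Real.sq_sqrt (div_nonneg hL (by positivity : (0 : ℝ) ≤ 2 * u))
    have hc := Real.sq_sqrt (div_nonneg hL (by positivity : (0 : ℝ) ≤ 2 * n))
    -- Dropping the cross terms of the square leaves 2L times the variance proxy 1/(4m) + 1/u +
    -- 1/(4n), so the tail is at most exp(-L) = δ/2.
    have hsq : L / (2 * m) + 4 * (L / (2 * u)) + L / (2 * n) ≤ ε ^ 2 := by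
      rw [← ha, ← hb, ← hc, hε]
      have h1 := mul_nonneg (Real.sqrt_nonneg (L / (2 * m))) (Real.sqrt_nonneg (L / (2 * u)))
      have h2 := mul_nonneg (Real.sqrt_nonneg (L / (2 * m))) (Real.sqrt_nonneg (L / (2 * n)))
      have h3 := mul_nonneg (Real.sqrt_nonneg (L / (2 * u))) (Real.sqrt_nonneg (L / (2 * n)))
      rw [ha, hb, hc]
      ring_nf at ha hb hc h1 h2 h3 ⊢
      nlinarith
    have hδL : δ / 2 = Real.exp (-L) := by
      rw [Real.exp_neg, hLdef, Real.exp_log (by positivity), inv_div]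
    rw [hδL]
    refine Real.exp_le_exp.2 ?_
    push_cast
    rw [neg_div, neg_le_neg_iff, le_div_iff₀ (by positivity)]
    refine le_trans (le_of_eq ?_) hsq
    field_simp
    ring

end

end PMD

/-! ### Assembly of the bound. -/

theorem mainTheorem3 {X : Type*} [MeasurableSpace X]
    -- labels, tie-breaking of the argmax, margin parameter
    (K : ℕ) (hK : 2 ≤ K)
    (sel : (Fin K → ℝ) → Fin K) (hsel : PMD.IsArgmaxRule sel) (hselm : Measurable sel)
    (ρ : ℝ) (hρ : 0 < ρ)
    -- scoring functions and labelling functions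
    (F : Set (X → Fin K → ℝ)) (hF : ∀ f ∈ F, Measurable f)
    (H : Set (X → Fin K)) (hFH : ∀ f ∈ F, PMD.induced sel f ∈ H)
    (hH : ∀ h ∈ H, ∀ τ : Equiv.Perm (Fin K), (fun x => τ (h x)) ∈ H)
    -- noisy source, proxy and target distributions of the features
    (Qn Q' P : Measure X)
    [IsProbabilityMeasure Qn] [IsProbabilityMeasure Q'] [IsProbabilityMeasure P]
    -- measurability of the suprema over the function classes
    (hmeas : ∀ D ∈ ({Qn, Q', P} : Set (Measure X)),
      PMD.IsMeasurableClass D (PMD.piClass H F) ∧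
      PMD.IsMeasurableClass D (PMD.centeredLossClass sel ρ F D))
    -- sample sizes and confidence
    (m u n : ℕ) (hm : 0 < m) (hu : 0 < u) (hn : 0 < n) (δ : ℝ) (hδ : 0 < δ) :
    ((PMD.sampleLaw m Qn).prod ((PMD.sampleLaw u Q').prod (PMD.sampleLaw n P)))
      {S | ¬ ∀ f ∈ F,
        ENNReal.ofReal
            |PMD.pmd sel ρ F f (PMD.empirical S.1) (PMD.empirical S.2.1) (PMD.empirical S.2.2)
              - PMD.pmd sel ρ F f Qn Q' P|
          ≤ ENNReal.ofReal (2 * K / ρ) * PMD.rademacher m Qn (PMD.piClass H F)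
            + ENNReal.ofReal (4 * K / ρ) * PMD.rademacher u Q' (PMD.piClass H F)
            + ENNReal.ofReal (2 * K / ρ) * PMD.rademacher n P (PMD.piClass H F)
            + ENNReal.ofReal
                (√(Real.log (2 / δ) / (2 * m)) + 2 * √(Real.log (2 / δ) / (2 * u))
                  + √(Real.log (2 / δ) / (2 * n)))}
      ≤ ENNReal.ofReal (2 * δ) := by
  open PMD in
  have hK0 : (0 : ℝ) < K := Nat.cast_pos.2 (by omega)
  rcases F.eq_empty_or_nonempty with rfl | hF0
  · simp
  -- For δ ≥ 1 the bound 2δ exceeds 1; otherwise log(2/δ) is nonnegative, as the tail bound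
  -- requires.
  rcases le_total 1 δ with hδ1 | hδ1
  · exact prob_le_one.trans (ENNReal.one_le_ofReal.2 (by linarith))
  have h2K : ENNReal.ofReal (2 * K / ρ) ≠ 0 := (ENNReal.ofReal_pos.2 (by positivity)).ne'
  have h4K : ENNReal.ofReal (4 * K / ρ) ≠ 0 := (ENNReal.ofReal_pos.2 (by positivity)).ne'
  by_cases hR₁ : rademacher m Qn (piClass H F) = ⊤
  · simp [hR₁, ENNReal.mul_top h2K]
  by_cases hR₂ : rademacher u Q' (piClass H F) = ⊤
  · simp [hR₂, ENNReal.mul_top h4K]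
  by_cases hR₃ : rademacher n P (piClass H F) = ⊤
  · simp [hR₃, ENNReal.mul_top h2K]
  obtain ⟨g₁, c₁⟩ := hmeas Qn (by simp)
  obtain ⟨g₂, c₂⟩ := hmeas Q' (by simp)
  obtain ⟨g₃, c₃⟩ := hmeas P (by simp)
  have ha : ∀ N : ℕ, |(N : ℝ)⁻¹| = (N : ℝ)⁻¹ := fun N => abs_of_nonneg (by positivity)
  have hb : ∀ N : ℕ, |-(N : ℝ)⁻¹| = (N : ℝ)⁻¹ := fun N => (abs_neg _).trans (ha N)
  have E₁ := fun w (hw : |w| = (m : ℝ)⁻¹) =>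
    integral_indexedSup_centeredLoss_le hK hselm hρ hF0 hF hFH hH g₁ c₁ hm hR₁ hw
  have E₂ := fun w (hw : |w| = (u : ℝ)⁻¹) =>
    integral_indexedSup_centeredLoss_le hK hselm hρ hF0 hF hFH hH g₂ c₂ hu hR₂ hw
  have E₃ := fun w (hw : |w| = (n : ℝ)⁻¹) =>
    integral_indexedSup_centeredLoss_le hK hselm hρ hF0 hF hFH hH g₃ c₃ hn hR₃ hw
  have t₁ := measure_indexedSup_add_ge_le hF0 c₁ c₂ c₃ hm hu hn (hb m) (ha u) (ha n)
    (E₁ _ (hb m)) (E₂ _ (ha u)) (E₂ _ (hb u)) (E₃ _ (ha n)) hδ (by linarith)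
  have t₂ := measure_indexedSup_add_ge_le hF0 c₁ c₂ c₃ hm hu hn (ha m) (ha u) (hb n)
    (E₁ _ (ha m)) (E₂ _ (ha u)) (E₂ _ (hb u)) (E₃ _ (hb n)) hδ (by linarith)
  -- Failure forces one of two tail events, one for each sign of the error.
  refine (measure_mono fun S hS => ?_).trans ((measure_union_le _ _).trans
    ((add_le_add t₁ t₂).trans ?_))
  · by_contra hnot
    simp only [Set.mem_union, Set.mem_ofPred_eq, not_or, not_le] at hnot
    refine hS fun f hf => ?_
    have h := abs_pmd_sub_le hselm hF hm hu hn S.1 S.2.1 S.2.2 hf hnot.1.le hnot.2.le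
    rw [← ENNReal.ofReal_toReal hR₁, ← ENNReal.ofReal_toReal hR₂, ← ENNReal.ofReal_toReal hR₃,
      ← ENNReal.ofReal_mul (by positivity), ← ENNReal.ofReal_mul (by positivity),
      ← ENNReal.ofReal_mul (by positivity), ← ENNReal.ofReal_add (by positivity) (by positivity),
      ← ENNReal.ofReal_add (by positivity) (by positivity),
      ← ENNReal.ofReal_add (by positivity) (by positivity)]
    refine ENNReal.ofReal_le_ofReal (h.trans (add_le_add ?_ le_rfl))
    have k : ∀ R : ℝ≥0∞, 0 ≤ K / ρ * R.toReal := fun R => by positivity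
    have k₁ := k (rademacher m Qn (piClass H F))
    have k₂ := k (rademacher u Q' (piClass H F))
    have k₃ := k (rademacher n P (piClass H F))
    -- The means contribute only half of the claimed complexity terms; nonnegativity of the rest
    -- closes the gap.
    rw [show 2 * K / ρ = 2 * (K / ρ) by ring, show 4 * K / ρ = 4 * (K / ρ) by ring]
    linarith
  · rw [← ENNReal.ofReal_add (by positivity) (by positivity)]
    exact ENNReal.ofReal_le_ofReal (by linarith)
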